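/- Let $g$ be a $C^1$ metric of signature $(-,+,+,+)$ on an open set $U\subset\mathbb R^4$ (a positively oriented coordinate patch of an oriented spacetime) with volume form $\eta$ and Christoffel symbols $\Gamma$, and let $c:\mathbb R\to\mathbb R$ be an arbitrary function. For a spacelike $C^2$ surface with positively oriented coordinates $x^A$ ($A=1,2$), embedding functions $\Phi^\alpha$, tangent vectors $e_A=\partial_A\Phi$, induced metric $h_{AB}=g(e_A,e_B)$ and area form $\eta_S$, let $\vec H=h^{AB}\vec K_{AB}$, $\vec K_{AB}=-(\nabla_{e_A}e_B)^\perp$, be the mean curvature vector, $H^2=g(\vec H,\vec H)$, and $W^{\star\alpha}=\tfrac12\eta^\alpha{}_{\beta\gamma\delta}W^\beta e_A^\gamma e_B^\delta\eta_S^{AB}$ the Hodge dual of a normal vector $W$. A uniformly expanding flow is a family $\Phi(\lambda,x)$ of such surfaces in $U$ with $H^2>0$ and $\partial_\lambda\Phi=\vec\xi=H^{-2}(\vec H-c(\lambda)\vec H^\star)$. (1) With $H^\mu=-\Delta_h\Phi^\mu-h^{AB}\Gamma^\mu_{\nu\rho}\,\partial_A\Phi^\nu\,\partial_B\Phi^\rho$,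 where $\Delta_h$ is the Laplacian of $h$, the flow equation is a second order system $\partial_\lambda\Phi^\alpha=J^\alpha(\lambda,\Phi,\partial\Phi,\partial^2\Phi)$: a family of spacelike $C^2$ surfaces in $U$ is a uniformly expanding flow if and only if it has $H^2>0$ and solves this system. Fix $\lambda$, a 2-jet (point of $U$, first derivatives, symmetric second derivatives) of a spacelike surface with $H^2>0$, and a unit covector $z$ of the surface, $h^{AB}z_Az_B=1$. Then $J$ is differentiable in $\partial^2\Phi$ at this jet; let $Q^\alpha{}_\beta=\dfrac{\partial J^\alpha}{\partial(\partial_A\partial_B\Phi^\beta)}z_Az_B$ be the principal symbol and, for a positive definite metric $L$ on $\mathbb R^4$, let $Q^\dagger$ be the transpose of $Q$ with respect to $L$. (2) The form $L_{\alpha\beta}=H^{-2}(H_\alpha H_\beta+H^\star_\alpha H^\star_\beta)$ is positive definite on the normal plane and extends to a positive definite metric $L$ on $\mathbb R^4$ for which the tangent plane is orthogonal to the normal plane. For every such extension, $Q+Q^\dagger$ has $\vec H$ and $\vec H^\star$ as eigenvectors, with eigenvalues $2/H^2$ and $-2/H^2$ respectively, and vanishes on the tangent plane. Hence $Q+Q^\dagger$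 is indefinite on the normal plane, i.e. $v\mapsto L((Q+Q^\dagger)v,v)$ takes both signs there: the system is forward-backward parabolic for every choice of $c$. (3) Indefiniteness does not depend on the symmetrizing metric: if $|c(\lambda)|\le1$, then for every positive definite metric $L$ on $\mathbb R^4$ the form $v\mapsto L((Q+Q^\dagger)v,v)$ takes both signs on the normal plane. -/

import Mathlib

open scoped Matrix

noncomputable section

namespace UEF

/-- Coordinates on (an open part of) the spacetime. -/
abbrev Spacetime := Fin 4 → ℝ

/-- Coordinates on the surface. -/
abbrev Param := Fin 2 → ℝ

/-- Values of the first derivatives `∂_A Φ`. -/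
abbrev Jet1 := Fin 2 → Spacetime

/-- Values of the second derivatives `∂_A ∂_B Φ`. -/
abbrev Jet2 := Fin 2 → Fin 2 → Spacetime

/-- The scalar product `v · w = G_{αβ} v^α w^β`. -/
def ip (G : Matrix (Fin 4) (Fin 4) ℝ) (v w : Spacetime) : ℝ := v ⬝ᵥ (G *ᵥ w)

/-- `G` is a symmetric bilinear form of signature `(-,+,+,+)`. -/
def IsLorentzian (G : Matrix (Fin 4) (Fin 4) ℝ) : Prop :=
  ∃ P : Matrix (Fin 4) (Fin 4) ℝ, IsUnit P.det ∧ Pᵀ * G * P = Matrix.diagonal ![-1, 1, 1, 1]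

/-- `∂_ν g_{σρ}` at `y`. -/
def dMetric (g : Spacetime → Matrix (Fin 4) (Fin 4) ℝ) (y : Spacetime) (ν σ ρ : Fin 4) : ℝ :=
  fderiv ℝ (fun q => g q σ ρ) y (Pi.single ν 1)

/-- The Christoffel symbols `Γ^μ_{νρ}` of the ambient metric. -/
def christoffel (g : Spacetime → Matrix (Fin 4) (Fin 4) ℝ) (y : Spacetime) (μ ν ρ : Fin 4) : ℝ :=
  (1 / 2) * ∑ σ, (g y)⁻¹ μ σ * (dMetric g y ν σ ρ + dMetric g y ρ σ ν - dMetric g y σ ν ρ)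

/-- The vector `Γ^μ_{νρ} v^ν w^ρ`. -/
def christoffelVec (g : Spacetime → Matrix (Fin 4) (Fin 4) ℝ) (y v w : Spacetime) : Spacetime :=
  fun μ => ∑ ν, ∑ ρ, christoffel g y μ ν ρ * v ν * w ρ

/-- The induced metric `h_{AB} = e_A · e_B` of the plane with (coordinate) basis `e_A = p A`. -/
def inducedMetric (G : Matrix (Fin 4) (Fin 4) ℝ) (p : Jet1) : Matrix (Fin 2) (Fin 2) ℝ :=
  Matrix.of fun A B => ip G (p A) (p B)

/-- `v` is orthogonal to all `e_A`. -/
def IsNormal (G : Matrix (Fin 4) (Fin 4) ℝ) (p : Jet1) (v : Spacetime) : Prop :=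
  ∀ A, ip G v (p A) = 0

/-- The normal part `v^⊥ = v - h^{AB} (v · e_A) e_B`. -/
def normalPart (G : Matrix (Fin 4) (Fin 4) ℝ) (p : Jet1) (v : Spacetime) : Spacetime :=
  v - ∑ A, ∑ B, ((inducedMetric G p)⁻¹ A B * ip G v (p A)) • p B

/-- The volume form `η_{αβγδ} u^α v^β w^γ s^δ` of `G`, in positively oriented coordinates. -/
def volumeForm (G : Matrix (Fin 4) (Fin 4) ℝ) (u v w s : Spacetime) : ℝ :=
  Real.sqrt |G.det| * Matrix.det (Matrix.of ![u, v, w, s])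

/-- The area form of the surface with both indices raised, `η_S^{AB}`, in positively oriented
coordinates. -/
def areaForm (G : Matrix (Fin 4) (Fin 4) ℝ) (p : Jet1) : Matrix (Fin 2) (Fin 2) ℝ :=
  (Real.sqrt (inducedMetric G p).det)⁻¹ • !![0, 1; -1, 0]

/-- The Hodge dual `(W⋆)^α = (1/2) η^α_{βγδ} W^β e_A^γ e_B^δ η_S^{AB}`. -/
def hodge (G : Matrix (Fin 4) (Fin 4) ℝ) (p : Jet1) (W : Spacetime) : Spacetime :=
  G⁻¹ *ᵥ fun μ => (1 / 2) * ∑ A, ∑ B,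
    volumeForm G (Pi.single μ 1) W (p A) (p B) * areaForm G p A B

/-! ### Geometry of a parametrized surface and the flow -/

/-- The coordinate tangent vectors `e_A = ∂F/∂x^A`. -/
def tangent (F : Param → Spacetime) (x : Param) : Jet1 :=
  fun A => fderiv ℝ F x (Pi.single A 1)

/-- The second derivatives `∂²F/∂x^A∂x^B`. -/
def secondDeriv (F : Param → Spacetime) (x : Param) : Jet2 :=
  fun A B => fderiv ℝ (fun q => tangent F q B) x (Pi.single A 1)

/-- The ambient covariant derivative `∇_{e_A} e_B` along the surface. -/
def covDeriv (g : Spacetime → Matrix (Fin 4) (Fin 4) ℝ) (F : Param → Spacetime) (x : Param)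
    (A B : Fin 2) : Spacetime :=
  secondDeriv F x A B + christoffelVec g (F x) (tangent F x A) (tangent F x B)

/-- The second fundamental tensor `K_{AB} = -(∇_{e_A} e_B)^⊥`. -/
def secondFundamental (g : Spacetime → Matrix (Fin 4) (Fin 4) ℝ) (F : Param → Spacetime)
    (x : Param) (A B : Fin 2) : Spacetime :=
  -normalPart (g (F x)) (tangent F x) (covDeriv g F x A B)

/-- The mean curvature vector `H = h^{AB} K_{AB}`. -/
def meanCurvature (g : Spacetime → Matrix (Fin 4) (Fin 4) ℝ) (F : Param → Spacetime)
    (x : Param) : Spacetime :=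
  ∑ A, ∑ B, (inducedMetric (g (F x)) (tangent F x))⁻¹ A B • secondFundamental g F x A B

/-- The combination `H^{-2} (H - c H⋆)` for a normal vector `H`. -/
def uefVector (G : Matrix (Fin 4) (Fin 4) ℝ) (p : Jet1) (c : ℝ) (H : Spacetime) : Spacetime :=
  (ip G H H)⁻¹ • (H - c • hodge G p H)

/-- For every parameter in `I`, the surface `Φ_λ` is of class `C²` on `W`, lies in `U` and is
spacelike. -/
def IsSpacelikeFamily (U : Set Spacetime) (g : Spacetime → Matrix (Fin 4) (Fin 4) ℝ)
    (I : Set ℝ) (W : Set Param) (Φ : ℝ → Param → Spacetime) : Prop :=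
  ∀ l ∈ I, ContDiffOn ℝ 2 (Φ l) W ∧
    ∀ x ∈ W, Φ l x ∈ U ∧ (inducedMetric (g (Φ l x)) (tangent (Φ l) x)).PosDef

/-- `Φ` is a uniformly expanding flow: the mean curvature vector is spacelike and the velocity
`∂Φ/∂λ` is `ξ = H^{-2} (H - c(λ) H⋆)`. -/
def IsUniformlyExpandingFlow (g : Spacetime → Matrix (Fin 4) (Fin 4) ℝ) (c : ℝ → ℝ)
    (I : Set ℝ) (W : Set Param) (Φ : ℝ → Param → Spacetime) : Prop :=
  ∀ l ∈ I, ∀ x ∈ W,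
    0 < ip (g (Φ l x)) (meanCurvature g (Φ l) x) (meanCurvature g (Φ l) x) ∧
    HasDerivAt (fun s => Φ s x)
      (uefVector (g (Φ l x)) (tangent (Φ l) x) (c l) (meanCurvature g (Φ l) x)) l

/-! ### The flow as a second order system for the embedding functions

Below `y`, `p A`, `r A B` stand for the values of `Φ`, `∂_A Φ`, `∂_A ∂_B Φ`. -/

/-- `∂_A h_{BD}` expressed through the embedding functions and their derivatives. -/
def dInduced (g : Spacetime → Matrix (Fin 4) (Fin 4) ℝ) (y : Spacetime) (p : Jet1) (r : Jet2)
    (A B D : Fin 2) : ℝ :=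
  (∑ ν, ∑ σ, ∑ ρ, dMetric g y ν σ ρ * p A ν * p B σ * p D ρ)
    + ip (g y) (r A B) (p D) + ip (g y) (p B) (r A D)

/-- The Christoffel symbols of the induced metric `h`. -/
def surfaceChristoffel (g : Spacetime → Matrix (Fin 4) (Fin 4) ℝ) (y : Spacetime) (p : Jet1)
    (r : Jet2) (C A B : Fin 2) : ℝ :=
  (1 / 2) * ∑ D, (inducedMetric (g y) p)⁻¹ C D *
    (dInduced g y p r A B D + dInduced g y p r B A D - dInduced g y p r D A B)

/-- The Laplacian of the surface applied to the embedding functions. -/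
def jetLaplacian (g : Spacetime → Matrix (Fin 4) (Fin 4) ℝ) (y : Spacetime) (p : Jet1)
    (r : Jet2) : Spacetime :=
  ∑ A, ∑ B, (inducedMetric (g y) p)⁻¹ A B •
    (r A B - ∑ C, surfaceChristoffel g y p r C A B • p C)

/-- The mean curvature vector as a second order expression in the embedding functions,
`H^μ = -Δ Φ^μ - h^{AB} Γ^μ_{νρ} ∂_A Φ^ν ∂_B Φ^ρ`. -/
def jetMeanCurvature (g : Spacetime → Matrix (Fin 4) (Fin 4) ℝ) (y : Spacetime) (p : Jet1)
    (r : Jet2) : Spacetime :=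
  -jetLaplacian g y p r
    - ∑ A, ∑ B, (inducedMetric (g y) p)⁻¹ A B • christoffelVec g y (p A) (p B)

/-- `H² = H · H` as a second order expression in the embedding functions. -/
def jetHSq (g : Spacetime → Matrix (Fin 4) (Fin 4) ℝ) (y : Spacetime) (p : Jet1) (r : Jet2) : ℝ :=
  ip (g y) (jetMeanCurvature g y p r) (jetMeanCurvature g y p r)

/-- The right hand side `J(λ, Φ, ∂Φ, ∂²Φ)` of the system. -/
def flowRHS (g : Spacetime → Matrix (Fin 4) (Fin 4) ℝ) (c : ℝ → ℝ) (l : ℝ) (y : Spacetime)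
    (p : Jet1) (r : Jet2) : Spacetime :=
  uefVector (g y) p (c l) (jetMeanCurvature g y p r)

/-- `Φ` solves the system `∂Φ/∂λ = J(λ, Φ, ∂Φ, ∂²Φ)` (on the domain `H² > 0` of `J`). -/
def SolvesSystem (g : Spacetime → Matrix (Fin 4) (Fin 4) ℝ) (c : ℝ → ℝ)
    (I : Set ℝ) (W : Set Param) (Φ : ℝ → Param → Spacetime) : Prop :=
  ∀ l ∈ I, ∀ x ∈ W,
    0 < jetHSq g (Φ l x) (tangent (Φ l) x) (secondDeriv (Φ l) x) ∧
    HasDerivAt (fun s => Φ s x)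
      (flowRHS g c l (Φ l x) (tangent (Φ l) x) (secondDeriv (Φ l) x)) l

/-- The principal symbol `Q^α_β = ∂J^α / ∂(∂_A ∂_B Φ^β) z_A z_B`. -/
def principalSymbol (g : Spacetime → Matrix (Fin 4) (Fin 4) ℝ) (c : ℝ → ℝ) (l : ℝ)
    (y : Spacetime) (p : Jet1) (r : Jet2) (z : Fin 2 → ℝ) : Matrix (Fin 4) (Fin 4) ℝ :=
  Matrix.of fun α β => ∑ A, ∑ B,
    fderiv ℝ (flowRHS g c l y p) r (Pi.single A (Pi.single B (Pi.single β 1))) α * z A * z B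

/-- The data `(y, p, r, z)`: a 2-jet (with symmetric second derivatives) at a point of `U` of a
spacelike surface whose mean curvature vector is spacelike, and a covector `z` of unit length. -/
structure IsAdmissible (U : Set Spacetime) (g : Spacetime → Matrix (Fin 4) (Fin 4) ℝ)
    (y : Spacetime) (p : Jet1) (r : Jet2) (z : Fin 2 → ℝ) : Prop where
  mem : y ∈ U
  spacelike : (inducedMetric (g y) p).PosDef
  symm : ∀ A B, r A B = r B A
  hSq_pos : 0 < jetHSq g y p r
  unit : z ⬝ᵥ ((inducedMetric (g y) p)⁻¹ *ᵥ z) = 1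

/-! ### Symmetrization -/

/-- The transpose `Q†` with respect to the metric `L`, i.e. `L(Q† v, w) = L(v, Q w)`. -/
def transposeWrt (L Q : Matrix (Fin 4) (Fin 4) ℝ) : Matrix (Fin 4) (Fin 4) ℝ :=
  L⁻¹ * Qᵀ * L

/-- The symmetrization `Q + Q†` with respect to `L`. -/
def symmetrized (L Q : Matrix (Fin 4) (Fin 4) ℝ) : Matrix (Fin 4) (Fin 4) ℝ :=
  Q + transposeWrt L Q

/-- The form `L(M v, v)` takes both signs on the normal space. -/
def IsIndefinite (G : Matrix (Fin 4) (Fin 4) ℝ) (p : Jet1) (L M : Matrix (Fin 4) (Fin 4) ℝ) :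
    Prop :=
  (∃ v, IsNormal G p v ∧ 0 < (M *ᵥ v) ⬝ᵥ (L *ᵥ v)) ∧
  (∃ w, IsNormal G p w ∧ (M *ᵥ w) ⬝ᵥ (L *ᵥ w) < 0)

/-- `L_{αβ} = H^{-2} (H_α H_β + H⋆_α H⋆_β)`. -/
def normalMetric (G : Matrix (Fin 4) (Fin 4) ℝ) (p : Jet1) (H : Spacetime) :
    Matrix (Fin 4) (Fin 4) ℝ :=
  (ip G H H)⁻¹ • (Matrix.vecMulVec (G *ᵥ H) (G *ᵥ H)
    + Matrix.vecMulVec (G *ᵥ hodge G p H) (G *ᵥ hodge G p H))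

/-- `L` is a positive definite metric which coincides with `normalMetric` as soon as one argument
is normal (`normalMetric` is degenerate on the tangent plane and is completed there arbitrarily). -/
def ExtendsNormalMetric (G : Matrix (Fin 4) (Fin 4) ℝ) (p : Jet1) (H : Spacetime)
    (L : Matrix (Fin 4) (Fin 4) ℝ) : Prop :=
  L.PosDef ∧ ∀ v, IsNormal G p v → L *ᵥ v = normalMetric G p H *ᵥ v

end UEF

end

/-!
The equivalence of the flow with the system is Gauss' formula: by `surfaceChristoffel_eq` the
Christoffel symbols of the induced metric are the tangential components of `∇_{e_A} e_B`, so
`-Δ Φ - h^{AB} Γ(e_A, e_B)` is the trace of the normal parts `-(∇_{e_A} e_B)^⊥`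
(`jetMeanCurvature_eq`). This uses the symmetry of second derivatives and of the metric only.

For the symbol, let `z` be a unit covector. Moving the second derivatives along `z ⊗ z ⊗ v` moves
the mean curvature vector `H` with velocity `-v^⊥` (`jetMeanCurvature_add_smul`), hence
`Q v = 2 (H · v) H^{-4} (H - c H⋆) - H^{-2} (v^⊥ - c (v^⊥)⋆)` (`isSymbol_principalSymbol`).
A Gram determinant (`ip_hodge_mul_ip_hodge`) gives `H⋆ · H⋆ = -H²` and `H⋆⋆ = H`, so `Q` vanishes on
the tangent plane, takes values in the normal plane, and has there, in the basis `H, H⋆`, the matrix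
`H^{-2} [[1, c], [-c, -1]]`. The metric `L` makes this basis orthogonal with both vectors of squared
length `H²`, so that `Q†` has the transposed matrix, and the antisymmetric part `c` drops out of
`Q + Q†` (`ExtendsNormalMetric.symmetrized_mulVec`).

For an arbitrary positive definite `L`, `L((Q + Q†) v, v) = 2 L(Q v, v)`. If `|c| < 1`, then `Q` has
normal eigenvectors with eigenvalues `±√(1 - c²) / H²`, on which this form is positive respectively
negative; if `|c| = 1`, then `Q` is nilpotent and nonzero on the normal plane, and the form changes
sign along a line parallel to the kernel (`IsSymbol.isIndefinite`).
-/

namespace UEF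

variable {G : Matrix (Fin 4) (Fin 4) ℝ} {p : Jet1}

/-! ### The scalar product -/

theorem ip_add_left (G : Matrix (Fin 4) (Fin 4) ℝ) (u v w : Spacetime) :
    ip G (u + v) w = ip G u w + ip G v w := by
  simp [ip, add_dotProduct]

theorem ip_add_right (G : Matrix (Fin 4) (Fin 4) ℝ) (u v w : Spacetime) :
    ip G u (v + w) = ip G u v + ip G u w := by
  simp [ip, Matrix.mulVec_add]

theorem ip_sub_left (G : Matrix (Fin 4) (Fin 4) ℝ) (u v w : Spacetime) :
    ip G (u - v) w = ip G u w - ip G v w := by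
  simp [ip, sub_dotProduct]

theorem ip_sub_right (G : Matrix (Fin 4) (Fin 4) ℝ) (u v w : Spacetime) :
    ip G u (v - w) = ip G u v - ip G u w := by
  simp [ip, Matrix.mulVec_sub]

theorem ip_neg_left (G : Matrix (Fin 4) (Fin 4) ℝ) (u v : Spacetime) :
    ip G (-u) v = -ip G u v := by
  simp [ip]

theorem ip_smul_left (G : Matrix (Fin 4) (Fin 4) ℝ) (a : ℝ) (u v : Spacetime) :
    ip G (a • u) v = a * ip G u v := by
  simp [ip]

theorem ip_smul_right (G : Matrix (Fin 4) (Fin 4) ℝ) (a : ℝ) (u v : Spacetime) :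
    ip G u (a • v) = a * ip G u v := by
  simp [ip, Matrix.mulVec_smul]

theorem ip_sum_left {ι : Type*} (s : Finset ι) (G : Matrix (Fin 4) (Fin 4) ℝ)
    (u : ι → Spacetime) (v : Spacetime) :
    ip G (∑ i ∈ s, u i) v = ∑ i ∈ s, ip G (u i) v := by
  simp [ip, sum_dotProduct]

theorem ip_comm (hG : Gᵀ = G) (u v : Spacetime) : ip G u v = ip G v u := by
  unfold ip
  rw [Matrix.dotProduct_mulVec, ← Matrix.mulVec_transpose, hG, dotProduct_comm]

theorem IsLorentzian.transpose_eq (h : IsLorentzian G) : Gᵀ = G := by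
  obtain ⟨P, hP, h⟩ := h
  have hPt : IsUnit Pᵀ.det := by rwa [Matrix.det_transpose]
  have key : Pᵀ * Gᵀ * P = Pᵀ * G * P := by
    have := congrArg Matrix.transpose h
    rw [Matrix.diagonal_transpose, ← h] at this
    simpa [Matrix.transpose_mul, Matrix.mul_assoc] using this
  have h1 := congrArg (fun M => Pᵀ⁻¹ * (M * P⁻¹)) key
  simpa [Matrix.mul_assoc, Matrix.mul_nonsing_inv _ hP,
    Matrix.nonsing_inv_mul_cancel_left _ _ hPt] using h1

theorem IsLorentzian.det_neg (h : IsLorentzian G) : G.det < 0 := by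
  obtain ⟨P, -, h⟩ := h
  have h1 := congrArg Matrix.det h
  simp [Matrix.det_mul, Matrix.det_diagonal, Fin.prod_univ_four] at h1
  by_contra! h2
  nlinarith [mul_nonneg h2 (mul_self_nonneg P.det)]

theorem IsLorentzian.isUnit_det (h : IsLorentzian G) : IsUnit G.det :=
  h.det_neg.ne.isUnit

theorem eq_zero_of_forall_ip_eq_zero (hG : IsUnit G.det) {v : Spacetime}
    (h : ∀ w, ip G w v = 0) : v = 0 := by
  have h1 : G *ᵥ v = 0 := dotProduct_eq_zero _ fun w => by
    rw [dotProduct_comm]; exact h w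
  have h2 := congrArg (G⁻¹ *ᵥ ·) h1
  simpa [Matrix.nonsing_inv_mul _ hG] using h2

theorem eq_of_forall_ip_eq (hG : IsUnit G.det) {u v : Spacetime}
    (h : ∀ w, ip G w u = ip G w v) : u = v :=
  sub_eq_zero.1 (eq_zero_of_forall_ip_eq_zero hG fun w => by rw [ip_sub_right, h w, sub_self])

theorem inducedMetric_transpose (hG : Gᵀ = G) (p : Jet1) :
    (inducedMetric G p)ᵀ = inducedMetric G p := by
  ext A B
  exact ip_comm hG _ _

theorem inducedMetric_inv_comm (hG : Gᵀ = G) (p : Jet1) (A B : Fin 2) :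
    (inducedMetric G p)⁻¹ A B = (inducedMetric G p)⁻¹ B A := by
  have h := Matrix.transpose_nonsing_inv (inducedMetric G p)
  rw [inducedMetric_transpose hG] at h
  exact (congrFun (congrFun h B) A)

/-! ### The orthogonal projection onto the normal plane -/

theorem normalPart_add (G : Matrix (Fin 4) (Fin 4) ℝ) (p : Jet1) (u v : Spacetime) :
    normalPart G p (u + v) = normalPart G p u + normalPart G p v := by
  simp only [normalPart, ip_add_left, mul_add, add_smul, Finset.sum_add_distrib]
  abel

theorem normalPart_smul (G : Matrix (Fin 4) (Fin 4) ℝ) (p : Jet1) (a : ℝ) (v : Spacetime) :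
    normalPart G p (a • v) = a • normalPart G p v := by
  simp only [normalPart, ip_smul_left, smul_sub, Finset.smul_sum, smul_smul,
    mul_left_comm]

theorem normalPart_isNormal (hp : (inducedMetric G p).PosDef) (v : Spacetime) :
    IsNormal G p (normalPart G p v) := by
  intro C
  have hu : IsUnit (inducedMetric G p).det := hp.det_pos.ne'.isUnit
  have h1 : ∀ A, ∑ B, (inducedMetric G p)⁻¹ A B * ip G (p B) (p C)
      = (1 : Matrix (Fin 2) (Fin 2) ℝ) A C := fun A => by
    rw [← Matrix.nonsing_inv_mul _ hu]; rfl
  have h2 : ∑ A, ∑ B, (inducedMetric G p)⁻¹ A B * ip G v (p A) * ip G (p B) (p C)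
      = ∑ A, ip G v (p A) * (1 : Matrix (Fin 2) (Fin 2) ℝ) A C := by
    refine Finset.sum_congr rfl fun A _ => ?_
    rw [← h1, Finset.mul_sum]
    exact Finset.sum_congr rfl fun B _ => by ring
  simp only [normalPart, ip_sub_left, ip_sum_left, ip_smul_left, h2]
  simp [Matrix.one_apply]

theorem normalPart_of_isNormal {v : Spacetime} (hv : IsNormal G p v) : normalPart G p v = v := by
  have hv' : ∀ A, ip G v (p A) = 0 := hv
  simp [normalPart, hv']

theorem normalPart_tangent (hp : (inducedMetric G p).PosDef) (C : Fin 2) :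
    normalPart G p (p C) = 0 := by
  have hu : IsUnit (inducedMetric G p).det := hp.det_pos.ne'.isUnit
  have h1 : ∀ B, ∑ A, (inducedMetric G p)⁻¹ A B * ip G (p C) (p A)
      = (1 : Matrix (Fin 2) (Fin 2) ℝ) C B := fun B => by
    rw [← Matrix.mul_nonsing_inv _ hu, Matrix.mul_apply]
    exact Finset.sum_congr rfl fun A _ => mul_comm _ _
  rw [normalPart, Finset.sum_comm]
  simp only [← Finset.sum_smul, h1]
  simp [Matrix.one_apply]

theorem ip_normalPart_right (hG : Gᵀ = G) {n : Spacetime} (hn : IsNormal G p n) (v : Spacetime) :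
    ip G n (normalPart G p v) = ip G n v := by
  rw [ip_comm hG, ip_comm hG n]
  simp only [normalPart, ip_sub_left, ip_sum_left, ip_smul_left]
  have h : ∀ B, ip G (p B) n = 0 := fun B => (ip_comm hG _ _).trans (hn B)
  simp [h]

theorem IsNormal.add {u v : Spacetime} (hu : IsNormal G p u) (hv : IsNormal G p v) :
    IsNormal G p (u + v) := fun A => by rw [ip_add_left, hu A, hv A, add_zero]

theorem IsNormal.smul {v : Spacetime} (a : ℝ) (hv : IsNormal G p v) :
    IsNormal G p (a • v) := fun A => by rw [ip_smul_left, hv A, mul_zero]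

theorem IsNormal.sub {u v : Spacetime} (hu : IsNormal G p u) (hv : IsNormal G p v) :
    IsNormal G p (u - v) := fun A => by rw [ip_sub_left, hu A, hv A, sub_zero]

/-! ### The Hodge dual of a normal vector -/

/-- Expansion of a `4 × 4` determinant along the first row. -/
theorem sum_mul_det_single (v a b d : Spacetime) :
    ∑ μ, v μ * Matrix.det (Matrix.of ![Pi.single μ 1, a, b, d])
      = Matrix.det (Matrix.of ![v, a, b, d]) := by
  simp only [Matrix.det_succ_row_zero (n := 3), Finset.mul_sum]
  rw [Finset.sum_comm]
  refine Finset.sum_congr rfl fun j _ => ?_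
  rw [Finset.sum_eq_single j]
  · have : ∀ u : Spacetime, (Matrix.of ![u, a, b, d]).submatrix Fin.succ j.succAbove
        = Matrix.of (fun i k => ![a, b, d] i (j.succAbove k)) := fun u => by ext; simp
    simp only [this]
    simp
    ring
  · intro μ _ hμ
    simp [hμ.symm]
  · simp

/-- The pairing with the Hodge dual is a determinant: raising and lowering the index cancel, and the
two terms `AB = 01, 10` of the contraction with the area form coincide. -/
theorem ip_hodge (hG : IsUnit G.det) (p : Jet1) (v W : Spacetime) :
    ip G v (hodge G p W) = Real.sqrt |G.det| * (Real.sqrt (inducedMetric G p).det)⁻¹ *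
      Matrix.det (Matrix.of ![v, W, p 0, p 1]) := by
  have hswap : ∀ μ : Fin 4, Matrix.det (Matrix.of ![Pi.single μ 1, W, p 1, p 0])
      = -Matrix.det (Matrix.of ![Pi.single μ 1, W, p 0, p 1]) := fun μ => by
    have h := Matrix.det_permute (Equiv.swap 2 3) (Matrix.of ![Pi.single μ 1, W, p 0, p 1])
    rw [Equiv.Perm.sign_swap (by decide)] at h
    have h' : Matrix.of ![Pi.single μ 1, W, p 1, p 0] =
        (Matrix.of ![Pi.single μ 1, W, p 0, p 1]).submatrix (Equiv.swap 2 3) id := by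
      ext i j
      fin_cases i <;> rfl
    rw [h', h]
    simp
  rw [ip, hodge, Matrix.mulVec_mulVec, Matrix.mul_nonsing_inv _ hG, Matrix.one_mulVec,
    ← sum_mul_det_single, Finset.mul_sum, dotProduct]
  refine Finset.sum_congr rfl fun μ _ => ?_
  simp only [volumeForm, areaForm, Fin.sum_univ_two, hswap]
  simp
  ring

theorem ip_hodge_swap (hG : IsUnit G.det) (p : Jet1) (v W : Spacetime) :
    ip G v (hodge G p W) = -ip G W (hodge G p v) := by
  rw [ip_hodge hG, ip_hodge hG]
  have : Matrix.det (Matrix.of ![v, W, p 0, p 1]) = - Matrix.det (Matrix.of ![W, v, p 0, p 1]) := by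
    have h := Matrix.det_permute (Equiv.swap 0 1) (Matrix.of ![W, v, p 0, p 1])
    rw [Equiv.Perm.sign_swap (by decide)] at h
    have h' : Matrix.of ![v, W, p 0, p 1] =
        (Matrix.of ![W, v, p 0, p 1]).submatrix (Equiv.swap 0 1) id := by
      ext i j
      fin_cases i <;> rfl
    rw [h', h]
    simp
  rw [this]; ring

theorem ip_self_hodge (hG : IsUnit G.det) (p : Jet1) (W : Spacetime) :
    ip G W (hodge G p W) = 0 := by
  have := ip_hodge_swap hG p W W
  linarith

theorem ip_hodge_self (hG : IsLorentzian G) (p : Jet1) (W : Spacetime) :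
    ip G (hodge G p W) W = 0 := by
  rw [ip_comm hG.transpose_eq, ip_self_hodge hG.isUnit_det]

theorem hodge_sub_smul (hG : IsUnit G.det) (p : Jet1) (a : ℝ) (u v : Spacetime) :
    hodge G p (u - a • v) = hodge G p u - a • hodge G p v := by
  refine eq_of_forall_ip_eq hG fun w => ?_
  rw [ip_hodge_swap hG, ip_sub_left, ip_smul_left, ip_sub_right, ip_smul_right,
    ip_hodge_swap hG p w u, ip_hodge_swap hG p w v]
  ring

theorem hodge_zero (hG : IsUnit G.det) (p : Jet1) : hodge G p 0 = 0 :=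
  eq_zero_of_forall_ip_eq_zero hG fun w => by
    rw [ip_hodge_swap hG, ip, zero_dotProduct, neg_zero]

theorem hodge_isNormal (hG : IsLorentzian G) (p : Jet1) (W : Spacetime) :
    IsNormal G p (hodge G p W) := by
  intro A
  rw [ip_comm hG.transpose_eq, ip_hodge hG.isUnit_det]
  have : Matrix.det (Matrix.of ![p A, W, p 0, p 1]) = 0 := by
    fin_cases A
    · exact Matrix.det_zero_of_row_eq (i := 0) (j := 2) (by decide) rfl
    · exact Matrix.det_zero_of_row_eq (i := 0) (j := 3) (by decide) rfl
  rw [this, mul_zero]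

/-- The Gram determinant identity for the Hodge dual. The product of the two determinants which
compute the left hand side is, up to the factor `G.det < 0`, the determinant of the matrix of
scalar products, which is block triangular. -/
theorem ip_hodge_mul_ip_hodge (hG : IsLorentzian G) (hp : (inducedMetric G p).PosDef)
    {u W W' : Spacetime} (hu : IsNormal G p u) (hW : IsNormal G p W)
    (v : Spacetime) :
    ip G u (hodge G p W) * ip G v (hodge G p W')
      = -(ip G u v * ip G W W' - ip G u W' * ip G W v) := by
  have hd := hp.det_pos
  set M := Matrix.of ![u, W, p 0, p 1] with hM
  set M' := Matrix.of ![v, W', p 0, p 1] with hM'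
  have hgram : M.det * G.det * M'.det
      = (ip G u v * ip G W W' - ip G u W' * ip G W v) * (inducedMetric G p).det := by
    have h1 : M * G * M'ᵀ = Matrix.of fun i j => ip G (M i) (M' j) := by
      ext i j
      rw [Matrix.mul_assoc]
      simp only [Matrix.mul_apply, Matrix.of_apply, ip, dotProduct, Matrix.mulVec,
        Matrix.transpose_apply]
    have h3 : (Matrix.of fun i j => ip G (M i) (M' j)).submatrix
        (finSumFinEquiv (m := 2) (n := 2)) (finSumFinEquiv (m := 2) (n := 2))
        = Matrix.fromBlocks !![ip G u v, ip G u W'; ip G W v, ip G W W'] 0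
          (Matrix.of fun A => ![ip G (p A) v, ip G (p A) W']) (inducedMetric G p) := by
      ext i j
      rcases i with i | i <;> rcases j with j | j <;> fin_cases i <;> fin_cases j <;>
        first | rfl | exact hu _ | exact hW _
    rw [← Matrix.det_transpose M', ← Matrix.det_mul, ← Matrix.det_mul, h1,
      ← Matrix.det_submatrix_equiv_self (finSumFinEquiv (m := 2) (n := 2)), h3,
      Matrix.det_fromBlocks_zero₁₂, Matrix.det_fin_two_of]
  have hk : (Real.sqrt |G.det| * (Real.sqrt (inducedMetric G p).det)⁻¹) ^ 2
      * (inducedMetric G p).det = -G.det := by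
    rw [mul_pow, inv_pow, Real.sq_sqrt (abs_nonneg _), Real.sq_sqrt hd.le,
      abs_of_neg hG.det_neg]
    field_simp
  rw [ip_hodge hG.isUnit_det, ip_hodge hG.isUnit_det]
  refine mul_right_cancel₀ hd.ne' ?_
  linear_combination M.det * M'.det * hk - hgram

/-! ### The Hodge dual of a spacelike normal vector -/

variable {H : Spacetime}

/-- There is a nonzero vector orthogonal to any three given ones. -/
theorem exists_ne_zero_ip_eq_zero (G : Matrix (Fin 4) (Fin 4) ℝ) (p : Jet1) (H : Spacetime) :
    ∃ u : Spacetime, u ≠ 0 ∧ IsNormal G p u ∧ ip G u H = 0 := by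
  obtain ⟨u, hu, hu'⟩ := (Matrix.exists_mulVec_eq_zero_iff
    (M := Matrix.of ![G *ᵥ H, G *ᵥ p 0, G *ᵥ p 1, 0])).2
      (Matrix.det_eq_zero_of_row_eq_zero 3 fun j => rfl)
  have h : ∀ i, (Matrix.of ![G *ᵥ H, G *ᵥ p 0, G *ᵥ p 1, 0]) i ⬝ᵥ u = 0 := fun i =>
    congrFun hu' i
  refine ⟨u, hu, fun A => ?_, (dotProduct_comm _ _).trans (h 0)⟩
  fin_cases A
  exacts [(dotProduct_comm _ _).trans (h 1), (dotProduct_comm _ _).trans (h 2)]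

/-- The Hodge dual reverses the causal character of a non-null normal vector. -/
theorem ip_hodge_hodge (hG : IsLorentzian G) (hp : (inducedMetric G p).PosDef)
    (hH : IsNormal G p H) (hpos : 0 < ip G H H) :
    ip G (hodge G p H) (hodge G p H) = -ip G H H := by
  have hs := hG.transpose_eq
  -- The identity holds because of `h1` as soon as the dual does not vanish, and it does not vanish
  -- because its pairing with a vector orthogonal to `H` and to the surface is nonzero.
  have h1 : ∀ v, ip G v (hodge G p H) * (ip G (hodge G p H) (hodge G p H) + ip G H H) = 0 :=
    fun v => by
      have h := ip_hodge_mul_ip_hodge (W' := H) hG hp (hodge_isNormal hG p H) hH v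
      rw [ip_hodge_self hG, ip_comm hs _ v] at h
      linear_combination h
  obtain ⟨u, hu0, hu, huH⟩ := exists_ne_zero_ip_eq_zero G p H
  by_contra hne
  have h2 : ∀ v, ip G v (hodge G p H) = 0 := fun v =>
    (mul_eq_zero.1 (h1 v)).resolve_right fun h => hne (by linarith)
  refine hu0 (eq_zero_of_forall_ip_eq_zero hG.isUnit_det fun v => ?_)
  have h := ip_hodge_mul_ip_hodge (W' := H) hG hp hu hH v
  rw [h2, huH, ip_comm hs u v] at h
  have : ip G v u * ip G H H = 0 := by linear_combination h
  exact (mul_eq_zero.1 this).resolve_right hpos.ne'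

/-- The Hodge dual is an involution on the normal plane (which has signature `(-,+)`). -/
theorem hodge_hodge (hG : IsLorentzian G) (hp : (inducedMetric G p).PosDef)
    (hH : IsNormal G p H) (hpos : 0 < ip G H H) :
    hodge G p (hodge G p H) = H := by
  have hs := hG.transpose_eq
  refine eq_of_forall_ip_eq hG.isUnit_det fun v => ?_
  have h := ip_hodge_mul_ip_hodge (W' := hodge G p H) hG hp (hodge_isNormal hG p H) hH v
  rw [ip_self_hodge hG.isUnit_det, ip_hodge_hodge hG hp hH hpos] at h
  refine mul_left_cancel₀ hpos.ne' ?_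
  rw [ip_comm hs v H]
  linear_combination -h

theorem ip_hodge_normalPart (hG : IsLorentzian G) {n : Spacetime} (w : Spacetime) :
    ip G n (hodge G p (normalPart G p w)) = -ip G w (hodge G p n) := by
  rw [ip_hodge_swap hG.isUnit_det, ip_comm hG.transpose_eq,
    ip_normalPart_right hG.transpose_eq (hodge_isNormal hG p n), ip_comm hG.transpose_eq]

/-! ### The metric on the normal plane -/

theorem mulVec_dotProduct_eq_ip (G : Matrix (Fin 4) (Fin 4) ℝ) (u v : Spacetime) :
    (G *ᵥ u) ⬝ᵥ v = ip G v u := dotProduct_comm _ _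

theorem normalMetric_mulVec (G : Matrix (Fin 4) (Fin 4) ℝ) (p : Jet1) (H v : Spacetime) :
    normalMetric G p H *ᵥ v = (ip G H H)⁻¹ •
      (ip G v H • G *ᵥ H + ip G v (hodge G p H) • G *ᵥ hodge G p H) := by
  simp [normalMetric, Matrix.smul_mulVec, Matrix.add_mulVec, Matrix.vecMulVec_mulVec,
    mulVec_dotProduct_eq_ip]

/-- An extension of the normal metric: complete it by `∑_A (e_A · v) (e_A · w)`. -/
theorem exists_extendsNormalMetric (hG : IsLorentzian G) (hp : (inducedMetric G p).PosDef)
    (hH : IsNormal G p H) (hpos : 0 < ip G H H) : ∃ L, ExtendsNormalMetric G p H L := by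
  have hs := hG.transpose_eq
  set X := hodge G p H with hX
  have hXX : ip G X X = -ip G H H := ip_hodge_hodge hG hp hH hpos
  set T : Matrix (Fin 4) (Fin 4) ℝ :=
    ∑ A, Matrix.vecMulVec (G *ᵥ p A) (G *ᵥ p A) with hT
  have hTv : ∀ v, T *ᵥ v = ∑ A, ip G v (p A) • G *ᵥ p A := fun v => by
    simp [hT, Fin.sum_univ_two, Matrix.add_mulVec, Matrix.vecMulVec_mulVec,
      mulVec_dotProduct_eq_ip]
  refine ⟨normalMetric G p H + T, ?_, fun v hv => ?_⟩
  · refine Matrix.PosDef.of_dotProduct_mulVec_pos ?_ fun v hv => ?_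
    · simp [Matrix.IsHermitian, Matrix.conjTranspose_eq_transpose_of_trivial, normalMetric, hT,
        Matrix.transpose_vecMulVec, Fin.sum_univ_two]
    · have hval : star v ⬝ᵥ ((normalMetric G p H + T) *ᵥ v)
          = (ip G H H)⁻¹ * (ip G v H ^ 2 + ip G v X ^ 2)
            + (ip G v (p 0) ^ 2 + ip G v (p 1) ^ 2) := by
        have h : ∀ w, v ⬝ᵥ (G *ᵥ w) = ip G v w := fun _ => rfl
        simp only [Matrix.add_mulVec, normalMetric_mulVec, hTv, Fin.sum_univ_two, star_trivial,
          dotProduct_add, dotProduct_smul, h, smul_eq_mul, ← hX]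
        ring
      rw [hval]
      by_contra! hle
      have hi : 0 < (ip G H H)⁻¹ := inv_pos.2 hpos
      have h0 : 0 ≤ (ip G H H)⁻¹ * (ip G v H ^ 2 + ip G v X ^ 2) := by positivity
      have h1 : ip G v (p 0) = 0 := by
        nlinarith [sq_nonneg (ip G v (p 0)), sq_nonneg (ip G v (p 1))]
      have h2 : ip G v (p 1) = 0 := by
        nlinarith [sq_nonneg (ip G v (p 0)), sq_nonneg (ip G v (p 1))]
      have h3 : ip G v H ^ 2 + ip G v X ^ 2 ≤ 0 := by
        by_contra! h
        nlinarith [mul_pos hi h]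
      have h4 : ip G v H = 0 := by nlinarith [sq_nonneg (ip G v H), sq_nonneg (ip G v X)]
      have hvn : IsNormal G p v := fun A => by fin_cases A; exacts [h1, h2]
      -- `v` is normal and orthogonal to `H` and `H⋆`, so by the Gram determinant identity it is
      -- orthogonal to everything
      refine hv (eq_zero_of_forall_ip_eq_zero hG.isUnit_det fun w => ?_)
      have h5 : ip G v X = 0 := by nlinarith [sq_nonneg (ip G v H), sq_nonneg (ip G v X)]
      have h := ip_hodge_mul_ip_hodge (W' := H) hG hp hvn hH w
      rw [← hX, h5, h4, ip_comm hs v w] at h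
      have : ip G w v * ip G H H = 0 := by linear_combination h
      exact (mul_eq_zero.1 this).resolve_right hpos.ne'
  · have hv' : ∀ A, ip G v (p A) = 0 := hv
    rw [Matrix.add_mulVec, hTv]
    simp [hv']

/-! ### The symbol as an operator -/

/-- The symbol of the system as an operator: it annihilates tangent vectors and takes values in the
normal plane, where it acts by `H ↦ H^{-2} (H - c H⋆)`, `H⋆ ↦ H^{-2} (c H - H⋆)`. -/
def IsSymbol (G : Matrix (Fin 4) (Fin 4) ℝ) (p : Jet1) (H : Spacetime) (c : ℝ)
    (Q : Matrix (Fin 4) (Fin 4) ℝ) : Prop :=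
  ∀ v, Q *ᵥ v = (2 * ip G H v * ((ip G H H) ^ 2)⁻¹) • (H - c • hodge G p H)
    - (ip G H H)⁻¹ • (normalPart G p v - c • hodge G p (normalPart G p v))

variable {c : ℝ} {L Q : Matrix (Fin 4) (Fin 4) ℝ}

namespace IsSymbol

theorem isNormal (hQ : IsSymbol G p H c Q) (hG : IsLorentzian G)
    (hp : (inducedMetric G p).PosDef) (hH : IsNormal G p H) (v : Spacetime) :
    IsNormal G p (Q *ᵥ v) := by
  rw [hQ v]
  exact ((hH.sub ((hodge_isNormal hG p _).smul _)).smul _).sub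
    (((normalPart_isNormal hp v).sub ((hodge_isNormal hG p _).smul _)).smul _)

theorem mulVec_tangent (hQ : IsSymbol G p H c Q) (hG : IsLorentzian G)
    (hp : (inducedMetric G p).PosDef) (hH : IsNormal G p H) (A : Fin 2) : Q *ᵥ p A = 0 := by
  have h : ip G H (p A) = 0 := hH A
  rw [hQ, h, normalPart_tangent hp, hodge_zero hG.isUnit_det]
  simp

theorem mulVec_self (hQ : IsSymbol G p H c Q) (hH : IsNormal G p H) (hpos : 0 < ip G H H) :
    Q *ᵥ H = (ip G H H)⁻¹ • (H - c • hodge G p H) := by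
  rw [hQ, normalPart_of_isNormal hH, ← sub_smul]
  congr 1
  field_simp
  ring

theorem mulVec_hodge (hQ : IsSymbol G p H c Q) (hG : IsLorentzian G)
    (hp : (inducedMetric G p).PosDef) (hH : IsNormal G p H) (hpos : 0 < ip G H H) :
    Q *ᵥ hodge G p H = (ip G H H)⁻¹ • (c • H - hodge G p H) := by
  rw [hQ, normalPart_of_isNormal (hodge_isNormal hG p H), hodge_hodge hG hp hH hpos,
    ip_self_hodge hG.isUnit_det]
  module

theorem ip_self (hQ : IsSymbol G p H c Q) (hG : IsLorentzian G) (hH : IsNormal G p H)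
    (hpos : 0 < ip G H H) (v : Spacetime) :
    ip G H (Q *ᵥ v) = (ip G H H)⁻¹ * (ip G v H - c * ip G v (hodge G p H)) := by
  rw [hQ, ip_sub_right, ip_smul_right, ip_smul_right, ip_sub_right, ip_sub_right, ip_smul_right,
    ip_smul_right, ip_self_hodge hG.isUnit_det, ip_hodge_normalPart hG,
    ip_normalPart_right hG.transpose_eq hH, ip_comm hG.transpose_eq H v]
  field_simp
  ring

theorem ip_hodge (hQ : IsSymbol G p H c Q) (hG : IsLorentzian G)
    (hp : (inducedMetric G p).PosDef) (hH : IsNormal G p H) (hpos : 0 < ip G H H)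
    (v : Spacetime) :
    ip G (hodge G p H) (Q *ᵥ v)
      = (ip G H H)⁻¹ * (c * ip G v H - ip G v (hodge G p H)) := by
  have hs := hG.transpose_eq
  rw [hQ, ip_sub_right, ip_smul_right, ip_smul_right, ip_sub_right, ip_sub_right, ip_smul_right,
    ip_smul_right, ip_hodge_self hG, ip_hodge_normalPart hG,
    ip_normalPart_right hs (hodge_isNormal hG p H), hodge_hodge hG hp hH hpos,
    ip_hodge_hodge hG hp hH hpos, ip_comm hs H v, ip_comm hs _ v]
  field_simp
  ring

end IsSymbol

/-! ### Symmetrization of the symbol -/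

theorem transposeWrt_mulVec_eq (hL : L.PosDef) {u w : Spacetime}
    (h : ∀ v, (L *ᵥ u) ⬝ᵥ (Q *ᵥ v) = (L *ᵥ w) ⬝ᵥ v) : transposeWrt L Q *ᵥ u = w := by
  have hu : IsUnit L.det := hL.det_pos.ne'.isUnit
  have h1 : Qᵀ *ᵥ (L *ᵥ u) = L *ᵥ w := by
    refine dotProduct_eq _ _ fun v => ?_
    rw [Matrix.mulVec_transpose, ← Matrix.dotProduct_mulVec]
    exact h v
  rw [transposeWrt, ← Matrix.mulVec_mulVec, ← Matrix.mulVec_mulVec, h1, Matrix.mulVec_mulVec,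
    Matrix.nonsing_inv_mul _ hu, Matrix.one_mulVec]

theorem symmetrized_quadratic (hL : L.PosDef) (Q : Matrix (Fin 4) (Fin 4) ℝ) (v : Spacetime) :
    (symmetrized L Q *ᵥ v) ⬝ᵥ (L *ᵥ v) = 2 * ip L (Q *ᵥ v) v := by
  have hs : Lᵀ = L := by simpa using hL.isHermitian.eq
  have hu : IsUnit L.det := hL.det_pos.ne'.isUnit
  have h : (transposeWrt L Q *ᵥ v) ⬝ᵥ (L *ᵥ v) = ip L (Q *ᵥ v) v := by
    change ip L _ _ = _
    rw [ip_comm hs, ip, transposeWrt, Matrix.mulVec_mulVec, Matrix.mul_assoc,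
      Matrix.mul_nonsing_inv_cancel_left _ _ hu, ← Matrix.mulVec_mulVec, Matrix.mulVec_transpose,
      dotProduct_comm, ← Matrix.dotProduct_mulVec, dotProduct_comm]
    rfl
  rw [symmetrized, Matrix.add_mulVec, add_dotProduct, h, ip]
  ring

theorem ip_pos (hL : L.PosDef) {v : Spacetime} (hv : v ≠ 0) : 0 < ip L v v := by
  simpa [ip] using hL.dotProduct_mulVec_pos hv

theorem ExtendsNormalMetric.symmetrized_mulVec (hL : ExtendsNormalMetric G p H L)
    (hQ : IsSymbol G p H c Q) (hG : IsLorentzian G)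
    (hp : (inducedMetric G p).PosDef) (hH : IsNormal G p H) (hpos : 0 < ip G H H) :
    symmetrized L Q *ᵥ H = (2 / ip G H H) • H ∧
    symmetrized L Q *ᵥ hodge G p H = (-2 / ip G H H) • hodge G p H ∧
    ∀ A, symmetrized L Q *ᵥ p A = 0 := by
  have hs := hG.transpose_eq
  have hLs : Lᵀ = L := by simpa using hL.1.isHermitian.eq
  have hXn := hodge_isNormal hG p H
  have hLH : L *ᵥ H = G *ᵥ H := by
    rw [hL.2 H hH, normalMetric_mulVec, ip_self_hodge hG.isUnit_det, zero_smul, add_zero,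
      smul_smul, inv_mul_cancel₀ hpos.ne', one_smul]
  have hLX : L *ᵥ hodge G p H = -(G *ᵥ hodge G p H) := by
    rw [hL.2 _ hXn, normalMetric_mulVec, ip_hodge_self hG, zero_smul,
      zero_add, smul_smul, ip_hodge_hodge hG hp hH hpos, mul_neg, inv_mul_cancel₀ hpos.ne',
      neg_smul, one_smul]
  refine ⟨?_, ?_, fun A => ?_⟩
  · have h : transposeWrt L Q *ᵥ H = (ip G H H)⁻¹ • (H + c • hodge G p H) := by
      refine transposeWrt_mulVec_eq hL.1 fun v => ?_
      rw [Matrix.mulVec_smul, Matrix.mulVec_add, Matrix.mulVec_smul, hLH, hLX, smul_dotProduct,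
        add_dotProduct, smul_dotProduct, neg_dotProduct, mulVec_dotProduct_eq_ip,
        mulVec_dotProduct_eq_ip, mulVec_dotProduct_eq_ip, ip_comm hs, hQ.ip_self hG hH hpos]
      simp only [smul_eq_mul]
      ring
    rw [symmetrized, Matrix.add_mulVec, h, hQ.mulVec_self hH hpos, div_eq_mul_inv]
    module
  · have h : transposeWrt L Q *ᵥ hodge G p H
        = (ip G H H)⁻¹ • (-c • H - hodge G p H) := by
      refine transposeWrt_mulVec_eq hL.1 fun v => ?_
      rw [Matrix.mulVec_smul, Matrix.mulVec_sub, Matrix.mulVec_smul, hLH, hLX, smul_dotProduct,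
        sub_dotProduct, smul_dotProduct, neg_dotProduct, neg_dotProduct, mulVec_dotProduct_eq_ip,
        mulVec_dotProduct_eq_ip, mulVec_dotProduct_eq_ip, ip_comm hs,
        hQ.ip_hodge hG hp hH hpos]
      simp only [smul_eq_mul]
      ring
    rw [symmetrized, Matrix.add_mulVec, h, hQ.mulVec_hodge hG hp hH hpos, div_eq_mul_inv]
    module
  · have h : transposeWrt L Q *ᵥ p A = 0 := by
      refine transposeWrt_mulVec_eq hL.1 fun v => ?_
      have h1 : ∀ n, IsNormal G p n → ip G (p A) n = 0 := fun n hn => (ip_comm hs _ _).trans (hn A)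
      have h2 : (L *ᵥ p A) ⬝ᵥ (Q *ᵥ v) = p A ⬝ᵥ (L *ᵥ (Q *ᵥ v)) := by
        rw [mulVec_dotProduct_eq_ip, ip_comm hLs]; rfl
      rw [h2, hL.2 _ (hQ.isNormal hG hp hH v), normalMetric_mulVec, dotProduct_smul,
        dotProduct_add, dotProduct_smul, dotProduct_smul]
      change _ • (_ • ip G _ _ + _ • ip G _ _) = _
      rw [h1 H hH, h1 _ hXn]
      simp
    rw [symmetrized, Matrix.add_mulVec, h, hQ.mulVec_tangent hG hp hH, add_zero]

theorem ne_zero_of_ip_ne_zero {v : Spacetime} (h : ip G v v ≠ 0) : v ≠ 0 := by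
  rintro rfl
  simp [ip] at h

/-- The determinant of the symbol on the normal plane is proportional to `c² - 1` and its trace is
zero. For `|c| < 1` it has normal eigenvectors with eigenvalues `±√(1 - c²) / H²`; for
`|c| = 1` it is nilpotent on the normal plane with kernel spanned by `k = H - c H⋆`, so that
`L(Q (H + t k), H + t k)` is affine and nonconstant in `t`. -/
theorem IsSymbol.isIndefinite (hQ : IsSymbol G p H c Q) (hG : IsLorentzian G)
    (hp : (inducedMetric G p).PosDef) (hH : IsNormal G p H) (hpos : 0 < ip G H H)
    (hc : |c| ≤ 1) (hL : L.PosDef) : IsIndefinite G p L (symmetrized L Q) := by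
  have hs := hG.transpose_eq
  have hXn := hodge_isNormal hG p H
  have hXX := ip_hodge_hodge hG hp hH hpos
  have hHX := ip_self_hodge hG.isUnit_det p H
  have hXH := ip_hodge_self hG p H
  have hQH := hQ.mulVec_self hH hpos
  have hQX := hQ.mulVec_hodge hG hp hH hpos
  set X := hodge G p H
  have hi : 0 < (ip G H H)⁻¹ := inv_pos.2 hpos
  have hne : ∀ a b : ℝ, a ≠ 0 ∨ b ≠ 0 → a • H + b • X ≠ 0 := fun a b hab h0 => by
    have h1 : ip G H (a • H + b • X) = a * ip G H H := by
      rw [ip_add_right, ip_smul_right, ip_smul_right, hHX, mul_zero, add_zero]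
    have h2 : ip G X (a • H + b • X) = -(b * ip G H H) := by
      rw [ip_add_right, ip_smul_right, ip_smul_right, hXX, hXH]; ring
    rw [h0] at h1 h2
    simp [ip] at h1 h2
    rcases hab with h | h
    · exact hpos.ne' (h1.resolve_left h)
    · exact hpos.ne' (h2.resolve_left h)
  rcases hc.lt_or_eq with hc | hc
  · have hc2 : 0 < 1 - c ^ 2 := by
      have := (sq_lt_one_iff_abs_lt_one c).2 hc
      linarith
    set s := Real.sqrt (1 - c ^ 2) with hsdef
    have hs0 : 0 < s := Real.sqrt_pos.2 hc2
    have hss : s ^ 2 = 1 - c ^ 2 := Real.sq_sqrt hc2.le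
    refine ⟨⟨(1 + s) • H + (-c) • X, (hH.smul _).add (hXn.smul _), ?_⟩,
      ⟨(-c) • H + (1 + s) • X, (hH.smul _).add (hXn.smul _), ?_⟩⟩
    · have h : Q *ᵥ ((1 + s) • H + (-c) • X) = ((ip G H H)⁻¹ * s) • ((1 + s) • H + (-c) • X) := by
        rw [Matrix.mulVec_add, Matrix.mulVec_smul, Matrix.mulVec_smul, hQH, hQX]
        match_scalars
        · linear_combination (-(ip G H H)⁻¹) * hss
        · ring
      rw [symmetrized_quadratic hL, h, ip_smul_left]
      have := ip_pos hL (hne (1 + s) (-c) (Or.inl (by positivity)))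
      positivity
    · have h : Q *ᵥ ((-c) • H + (1 + s) • X)
          = -((ip G H H)⁻¹ * s) • ((-c) • H + (1 + s) • X) := by
        rw [Matrix.mulVec_add, Matrix.mulVec_smul, Matrix.mulVec_smul, hQH, hQX]
        match_scalars
        · ring
        · linear_combination ((ip G H H)⁻¹) * hss
      rw [symmetrized_quadratic hL, h, ip_smul_left]
      have := ip_pos hL (hne (-c) (1 + s) (Or.inr (by positivity)))
      have : 0 < (ip G H H)⁻¹ * s * ip L ((-c) • H + (1 + s) • X) ((-c) • H + (1 + s) • X) := by
        positivity
      linarith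
  · have hc2 : c ^ 2 = 1 := by rw [← sq_abs, hc, one_pow]
    set k := H - c • X with hk
    have hkn : IsNormal G p k := hH.sub (hXn.smul _)
    have hQk : Q *ᵥ k = 0 := by
      rw [hk, Matrix.mulVec_sub, Matrix.mulVec_smul, hQH, hQX]
      match_scalars
      · linear_combination (-(ip G H H)⁻¹) * hc2
      · ring
    have hkk : 0 < ip L k k := by
      have h := hne 1 (-c) (Or.inl one_ne_zero)
      rw [one_smul, neg_smul, ← sub_eq_add_neg] at h
      exact ip_pos hL h
    have hq : ∀ t : ℝ, (symmetrized L Q *ᵥ (H + t • k)) ⬝ᵥ (L *ᵥ (H + t • k))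
        = 2 * (ip G H H)⁻¹ * (ip L k H + t * ip L k k) := fun t => by
      rw [symmetrized_quadratic hL, Matrix.mulVec_add, Matrix.mulVec_smul, hQk, hQH, smul_zero,
        add_zero, ip_smul_left, ip_add_right, ip_smul_right]
      ring
    refine ⟨⟨H + ((1 - ip L k H) / ip L k k) • k, hH.add (hkn.smul _), ?_⟩,
      ⟨H + ((-1 - ip L k H) / ip L k k) • k, hH.add (hkn.smul _), ?_⟩⟩
    · rw [hq, div_mul_cancel₀ _ hkk.ne']
      linarith
    · rw [hq, div_mul_cancel₀ _ hkk.ne']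
      linarith

theorem ExtendsNormalMetric.isIndefinite (hL : ExtendsNormalMetric G p H L)
    (hQ : IsSymbol G p H c Q) (hG : IsLorentzian G)
    (hp : (inducedMetric G p).PosDef) (hH : IsNormal G p H) (hpos : 0 < ip G H H) :
    IsIndefinite G p L (symmetrized L Q) := by
  obtain ⟨h1, h2, -⟩ := hL.symmetrized_mulVec hQ hG hp hH hpos
  have hXX := ip_hodge_hodge hG hp hH hpos
  refine ⟨⟨H, hH, ?_⟩, ⟨_, hodge_isNormal hG p H, ?_⟩⟩
  · rw [h1, smul_dotProduct]
    exact mul_pos (by positivity) (ip_pos hL.1 (ne_zero_of_ip_ne_zero hpos.ne'))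
  · rw [h2, smul_dotProduct]
    exact mul_neg_of_neg_of_pos (div_neg_of_neg_of_pos (by norm_num) hpos)
      (ip_pos hL.1 (ne_zero_of_ip_ne_zero (G := G) (by rw [hXX]; exact (neg_neg_of_pos hpos).ne)))

/-! ### The mean curvature vector as a second order expression -/

variable {g : Spacetime → Matrix (Fin 4) (Fin 4) ℝ} {y : Spacetime} {p : Jet1} {r : Jet2}

/-- The trilinear form `∂_ν g_{σρ} u^ν v^σ w^ρ`. -/
noncomputable def metricDeriv (g : Spacetime → Matrix (Fin 4) (Fin 4) ℝ) (y u v w : Spacetime) : ℝ :=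
  ∑ ν, ∑ σ, ∑ ρ, dMetric g y ν σ ρ * u ν * v σ * w ρ

theorem metricDeriv_swap (hd : ∀ ν σ ρ, dMetric g y ν σ ρ = dMetric g y ν ρ σ)
    (u v w : Spacetime) : metricDeriv g y u v w = metricDeriv g y u w v := by
  unfold metricDeriv
  refine Finset.sum_congr rfl fun ν _ => ?_
  rw [Finset.sum_comm]
  refine Finset.sum_congr rfl fun ρ _ => Finset.sum_congr rfl fun σ _ => ?_
  rw [hd]
  ring

theorem dMetric_swap {U : Set Spacetime} (hU : IsOpen U) (hL : ∀ y ∈ U, IsLorentzian (g y))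
    (hy : y ∈ U) (ν σ ρ : Fin 4) : dMetric g y ν σ ρ = dMetric g y ν ρ σ := by
  have h : (fun q => g q σ ρ) =ᶠ[nhds y] fun q => g q ρ σ := by
    filter_upwards [hU.mem_nhds hy] with q hq
    exact congrFun (congrFun (hL q hq).transpose_eq ρ) σ
  rw [dMetric, h.fderiv_eq, dMetric]

/-- The Christoffel symbols with lowered first index. -/
theorem ip_christoffelVec (hG : (g y)ᵀ = g y) (hu : IsUnit (g y).det) (v w u : Spacetime) :
    ip (g y) (christoffelVec g y v w) u = (1 / 2) *
      (metricDeriv g y v u w + metricDeriv g y w u v - metricDeriv g y u v w) := by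
  have h1 : christoffelVec g y v w = (g y)⁻¹ *ᵥ fun σ => (1 / 2) * ∑ ν, ∑ ρ,
      (dMetric g y ν σ ρ + dMetric g y ρ σ ν - dMetric g y σ ν ρ) * v ν * w ρ := by
    ext μ
    simp only [christoffelVec, christoffel, Matrix.mulVec, dotProduct, Finset.mul_sum,
      Finset.sum_mul]
    have hmove : ∀ f : Fin 4 → Fin 4 → Fin 4 → ℝ,
        ∑ σ, ∑ ν, ∑ ρ, f σ ν ρ = ∑ ν, ∑ ρ, ∑ σ, f σ ν ρ := fun f => by
      rw [Finset.sum_comm]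
      exact Finset.sum_congr rfl fun ν _ => Finset.sum_comm
    refine Eq.trans ?_ (hmove _).symm
    exact Finset.sum_congr rfl fun ν _ => Finset.sum_congr rfl fun ρ _ =>
      Finset.sum_congr rfl fun σ _ => by ring
  have hfst : metricDeriv g y v u w = ∑ σ, ∑ ν, ∑ ρ, dMetric g y ν σ ρ * v ν * u σ * w ρ :=
    Finset.sum_comm
  have hsnd : metricDeriv g y w u v = ∑ σ, ∑ ν, ∑ ρ, dMetric g y ρ σ ν * w ρ * u σ * v ν := by
    rw [metricDeriv, Finset.sum_comm]
    exact Finset.sum_congr rfl fun σ _ => Finset.sum_comm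
  rw [ip_comm hG, ip, h1, Matrix.mulVec_mulVec, Matrix.mul_nonsing_inv _ hu, Matrix.one_mulVec,
    hfst, hsnd, metricDeriv]
  simp only [dotProduct, ← Finset.sum_add_distrib, ← Finset.sum_sub_distrib, Finset.mul_sum]
  exact Finset.sum_congr rfl fun σ _ => Finset.sum_congr rfl fun ν _ =>
    Finset.sum_congr rfl fun ρ _ => by ring

theorem surfaceChristoffel_eq (hG : (g y)ᵀ = g y) (hu : IsUnit (g y).det)
    (hd : ∀ ν σ ρ, dMetric g y ν σ ρ = dMetric g y ν ρ σ) (hr : ∀ A B, r A B = r B A)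
    (C A B : Fin 2) :
    surfaceChristoffel g y p r C A B = ∑ D, (inducedMetric (g y) p)⁻¹ C D *
      ip (g y) (r A B + christoffelVec g y (p A) (p B)) (p D) := by
  rw [surfaceChristoffel, Finset.mul_sum]
  refine Finset.sum_congr rfl fun D _ => ?_
  rw [ip_add_left, ip_christoffelVec hG hu, metricDeriv_swap hd (p A) (p D),
    metricDeriv_swap hd (p B) (p D)]
  have hI : ∀ A B D, dInduced g y p r A B D = metricDeriv g y (p A) (p B) (p D)
      + ip (g y) (r A B) (p D) + ip (g y) (p B) (r A D) := fun _ _ _ => rfl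
  rw [hI, hI, hI, hr B A, hr D A, hr D B, ip_comm hG (p B) (r A D), ip_comm hG (p A) (r B D)]
  ring

/-- The Gauss formula: for symmetric second derivatives, `-Δ Φ - h^{AB} Γ(e_A, e_B)` is the trace
of the second fundamental tensor, the Laplacian supplying the tangential part. -/
theorem jetMeanCurvature_eq (hG : (g y)ᵀ = g y) (hu : IsUnit (g y).det)
    (hd : ∀ ν σ ρ, dMetric g y ν σ ρ = dMetric g y ν ρ σ) (hr : ∀ A B, r A B = r B A) :
    jetMeanCurvature g y p r = ∑ A, ∑ B, (inducedMetric (g y) p)⁻¹ A B •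
      -normalPart (g y) p (r A B + christoffelVec g y (p A) (p B)) := by
  rw [jetMeanCurvature, jetLaplacian, ← Finset.sum_neg_distrib, ← Finset.sum_sub_distrib]
  refine Finset.sum_congr rfl fun A _ => ?_
  rw [← Finset.sum_neg_distrib, ← Finset.sum_sub_distrib]
  refine Finset.sum_congr rfl fun B _ => ?_
  have h : ∑ C, surfaceChristoffel g y p r C A B • p C = ∑ D, ∑ C,
      ((inducedMetric (g y) p)⁻¹ D C *
        ip (g y) (r A B + christoffelVec g y (p A) (p B)) (p D)) • p C := by
    rw [Finset.sum_comm]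
    refine Finset.sum_congr rfl fun C _ => ?_
    rw [surfaceChristoffel_eq hG hu hd hr, Finset.sum_smul]
    exact Finset.sum_congr rfl fun D _ => by rw [inducedMetric_inv_comm hG]
  rw [h, normalPart]
  module

theorem jetMeanCurvature_isNormal (hG : (g y)ᵀ = g y) (hu : IsUnit (g y).det)
    (hd : ∀ ν σ ρ, dMetric g y ν σ ρ = dMetric g y ν ρ σ) (hr : ∀ A B, r A B = r B A)
    (hp : (inducedMetric (g y) p).PosDef) :
    IsNormal (g y) p (jetMeanCurvature g y p r) := by
  intro C
  have h : ∀ v, ip (g y) (normalPart (g y) p v) (p C) = 0 := fun v => normalPart_isNormal hp v C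
  simp only [jetMeanCurvature_eq hG hu hd hr, ip_sum_left, ip_smul_left, ip_neg_left, h]
  simp

theorem secondDeriv_comm {W : Set Param} (hW : IsOpen W) {F : Param → Spacetime}
    (hF : ContDiffOn ℝ 2 F W) {x : Param} (hx : x ∈ W) (A B : Fin 2) :
    secondDeriv F x A B = secondDeriv F x B A := by
  have hc : ContDiffAt ℝ 2 F x := hF.contDiffAt (hW.mem_nhds hx)
  have hd : DifferentiableAt ℝ (fderiv ℝ F) x :=
    (hc.fderiv_right (m := 1) (by norm_num)).differentiableAt (by norm_num)
  have h : ∀ A B : Fin 2, secondDeriv F x A B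
      = fderiv ℝ (fderiv ℝ F) x (Pi.single A 1) (Pi.single B 1) := fun A B => by
    simp only [secondDeriv, tangent]
    rw [fderiv_clm_apply hd (differentiableAt_const _)]
    simp
  rw [h, h]
  exact (hc.isSymmSndFDerivAt (by simp)) _ _

theorem meanCurvature_eq_jetMeanCurvature {U : Set Spacetime} (hU : IsOpen U)
    (hL : ∀ y ∈ U, IsLorentzian (g y)) {W : Set Param} (hW : IsOpen W)
    {F : Param → Spacetime} (hF : ContDiffOn ℝ 2 F W) {x : Param} (hx : x ∈ W) (hy : F x ∈ U) :
    meanCurvature g F x = jetMeanCurvature g (F x) (tangent F x) (secondDeriv F x) := by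
  have hG := hL _ hy
  rw [jetMeanCurvature_eq hG.transpose_eq hG.isUnit_det (dMetric_swap hU hL hy)
    (secondDeriv_comm hW hF hx)]
  rfl

/-! ### The principal symbol -/

theorem differentiable_jetMeanCurvature (g : Spacetime → Matrix (Fin 4) (Fin 4) ℝ)
    (y : Spacetime) (p : Jet1) : Differentiable ℝ (jetMeanCurvature g y p) := by
  have hr : ∀ A B, Differentiable ℝ fun r : Jet2 => r A B := fun A B => by fun_prop
  have hI : ∀ A B D, Differentiable ℝ fun r => dInduced g y p r A B D := fun A B D => by
    simp only [dInduced, ip, dotProduct, Matrix.mulVec]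
    fun_prop
  have hS : ∀ A B C, Differentiable ℝ fun r => surfaceChristoffel g y p r C A B := fun A B C => by
    simp only [surfaceChristoffel]
    fun_prop
  simp only [funext (jetMeanCurvature.eq_1 g y p), jetLaplacian]
  fun_prop

/-- Along the line `r + s z ⊗ z ⊗ v` of symmetric second derivatives, the mean curvature vector
moves with the constant velocity `-v^⊥`, because `z` is a unit covector. -/
theorem jetMeanCurvature_add_smul (hG : (g y)ᵀ = g y) (hu : IsUnit (g y).det)
    (hd : ∀ ν σ ρ, dMetric g y ν σ ρ = dMetric g y ν ρ σ) (hr : ∀ A B, r A B = r B A)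
    {z : Fin 2 → ℝ} (hz : z ⬝ᵥ ((inducedMetric (g y) p)⁻¹ *ᵥ z) = 1) (v : Spacetime) (s : ℝ) :
    jetMeanCurvature g y p (r + s • fun A B => (z A * z B) • v)
      = jetMeanCurvature g y p r - s • normalPart (g y) p v := by
  have hr' : ∀ A B, (r + s • fun A B => (z A * z B) • v : Jet2) A B
      = (r + s • fun A B => (z A * z B) • v : Jet2) B A := fun A B => by
    simp [hr A B, mul_comm (z A)]
  rw [jetMeanCurvature_eq hG hu hd hr, jetMeanCurvature_eq hG hu hd hr']
  have h : ∀ A B, normalPart (g y) p ((r + s • fun A B => (z A * z B) • v : Jet2) A B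
      + christoffelVec g y (p A) (p B))
      = normalPart (g y) p (r A B + christoffelVec g y (p A) (p B))
        + (s * (z A * z B)) • normalPart (g y) p v := fun A B => by
    rw [← normalPart_smul, ← normalPart_add]
    congr 1
    simp only [Pi.add_apply, Pi.smul_apply, smul_smul]
    abel
  have hz' : ∑ A, ∑ B, (inducedMetric (g y) p)⁻¹ A B * (z A * z B) = 1 := by
    rw [← hz]
    simp only [dotProduct, Matrix.mulVec, Finset.mul_sum]
    exact Finset.sum_congr rfl fun A _ => Finset.sum_congr rfl fun B _ => by ring
  simp only [h]
  have h2 : s • normalPart (g y) p v = ∑ A, ∑ B, ((inducedMetric (g y) p)⁻¹ A B *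
      (s * (z A * z B))) • normalPart (g y) p v := by
    simp only [← Finset.sum_smul]
    congr 1
    refine (mul_one s).symm.trans ?_
    rw [← hz']
    simp only [Finset.mul_sum]
    exact Finset.sum_congr rfl fun A _ => Finset.sum_congr rfl fun B _ => by ring
  rw [h2, ← Finset.sum_sub_distrib]
  refine Finset.sum_congr rfl fun A _ => ?_
  rw [← Finset.sum_sub_distrib]
  refine Finset.sum_congr rfl fun B _ => ?_
  module

/-- The right hand side of the system is a rational function of the second derivatives, with
denominator `H²`. -/
theorem differentiableAt_flowRHS (hu : IsUnit (g y).det) (c : ℝ → ℝ) (l : ℝ)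
    (hpos : 0 < jetHSq g y p r) : DifferentiableAt ℝ (flowRHS g c l y p) r := by
  have hH := differentiable_jetMeanCurvature g y p r
  have hip : DifferentiableAt ℝ
      (fun r => ip (g y) (jetMeanCurvature g y p r) (jetMeanCurvature g y p r)) r := by
    simp only [ip, dotProduct, Matrix.mulVec]
    fun_prop
  have hhodge : DifferentiableAt ℝ (fun r => hodge (g y) p (jetMeanCurvature g y p r)) r := by
    have h : IsLinearMap ℝ (hodge (g y) p) := {
      map_add := fun u v => by
        simpa using hodge_sub_smul hu p (-1) u v
      map_smul := fun a v => by
        simpa [hodge_zero hu] using hodge_sub_smul hu p (-a) 0 v }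
    exact (LinearMap.toContinuousLinearMap h.mk').differentiableAt.comp r hH
  exact (hip.inv hpos.ne').smul (hH.sub (hhodge.const_smul (c l)))

/-- The principal symbol applied to `v` is the derivative of `J` in the direction `z ⊗ z ⊗ v`. -/
theorem principalSymbol_mulVec {c : ℝ → ℝ} {l : ℝ} (z : Fin 2 → ℝ) (v : Spacetime) :
    principalSymbol g c l y p r z *ᵥ v
      = fderiv ℝ (flowRHS g c l y p) r (fun A B => (z A * z B) • v) := by
  have h : (fun A B => (z A * z B) • v : Jet2) = ∑ β, ∑ A, ∑ B, (z A * z B * v β) •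
      (Pi.single A (Pi.single B (Pi.single β 1)) : Jet2) := by
    ext A B β
    simp only [Finset.sum_apply, Pi.smul_apply, smul_eq_mul]
    rw [Finset.sum_eq_single β, Finset.sum_eq_single A, Finset.sum_eq_single B]
    · simp
    · intro B' _ hB'
      simp [hB'.symm]
    · simp
    · intro A' _ hA'
      simp [hA'.symm]
    · simp
    · intro β' _ hβ'
      refine Finset.sum_eq_zero fun A' _ => Finset.sum_eq_zero fun B' _ => ?_
      by_cases hA : A = A'
      · subst hA
        by_cases hB : B = B'
        · subst hB
          simp [hβ'.symm]
        · simp [hB]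
      · simp [hA]
    · simp
  rw [h]
  ext α
  simp only [map_sum, map_smul, Finset.sum_apply, Pi.smul_apply, smul_eq_mul, Matrix.mulVec,
    dotProduct, principalSymbol, Matrix.of_apply, Finset.sum_mul]
  refine Finset.sum_congr rfl fun β _ => Finset.sum_congr rfl fun A _ =>
    Finset.sum_congr rfl fun B _ => by ring

/-- Differentiate `J` along the line `r + s z ⊗ z ⊗ v`, on which it is an explicit function of `s`:
an affine function divided by a quadratic one. -/
theorem isSymbol_principalSymbol (hG : IsLorentzian (g y))
    (hd : ∀ ν σ ρ, dMetric g y ν σ ρ = dMetric g y ν ρ σ) (hr : ∀ A B, r A B = r B A)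
    {z : Fin 2 → ℝ} (hz : z ⬝ᵥ ((inducedMetric (g y) p)⁻¹ *ᵥ z) = 1) (c : ℝ → ℝ) (l : ℝ)
    (hp : (inducedMetric (g y) p).PosDef) (hpos : 0 < jetHSq g y p r) :
    IsSymbol (g y) p (jetMeanCurvature g y p r) (c l) (principalSymbol g c l y p r z) := by
  intro v
  set H := jetMeanCurvature g y p r with hH
  set n := normalPart (g y) p v with hn
  set t : Jet2 := fun A B => (z A * z B) • v with ht
  rw [principalSymbol_mulVec]
  have h1 : HasDerivAt (fun s : ℝ => flowRHS g c l y p (r + s • t))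
      (fderiv ℝ (flowRHS g c l y p) r t) 0 :=
    (differentiableAt_flowRHS hG.isUnit_det c l hpos).hasFDerivAt.hasLineDerivAt t
  refine h1.unique ?_
  have h2 : (fun s : ℝ => flowRHS g c l y p (r + s • t)) = fun s : ℝ =>
      (ip (g y) H H - s * (2 * ip (g y) H n) + s ^ 2 * ip (g y) n n)⁻¹ •
        ((H - c l • hodge (g y) p H) - s • (n - c l • hodge (g y) p n)) := by
    funext s
    rw [flowRHS, jetMeanCurvature_add_smul hG.transpose_eq hG.isUnit_det hd hr hz, uefVector,
      hodge_sub_smul hG.isUnit_det, ← hH, ← hn]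
    congr 1
    · simp only [ip_sub_left, ip_sub_right, ip_smul_left, ip_smul_right,
        ip_comm hG.transpose_eq n H]
      congr 1
      ring
    · module
  rw [h2]
  have hne : ip (g y) H H ≠ 0 := hpos.ne'
  have h3 : HasDerivAt (fun s : ℝ => ip (g y) H H - s * (2 * ip (g y) H n) + s ^ 2 * ip (g y) n n)
      (-(2 * ip (g y) H n)) 0 :=
    ((((hasDerivAt_id' (0 : ℝ)).mul_const (2 * ip (g y) H n)).const_sub (ip (g y) H H)).fun_add
      ((hasDerivAt_pow 2 (0 : ℝ)).mul_const (ip (g y) n n))).congr_deriv (by simp)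
  have h4 : HasDerivAt (fun s : ℝ => (H - c l • hodge (g y) p H) - s • (n - c l • hodge (g y) p n))
      (-(n - c l • hodge (g y) p n)) 0 :=
    (((hasDerivAt_id' (0 : ℝ)).smul_const (n - c l • hodge (g y) p n)).const_sub
      (H - c l • hodge (g y) p H)).congr_deriv (by simp)
  have h5 := (h3.fun_inv (by simpa using hne)).fun_smul h4
  refine h5.congr_deriv ?_
  have hn' : ip (g y) H n = ip (g y) H v :=
    ip_normalPart_right hG.transpose_eq
      (jetMeanCurvature_isNormal hG.transpose_eq hG.isUnit_det hd hr hp) v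
  rw [hn', zero_mul, sub_zero, zero_pow two_ne_zero, zero_mul, add_zero, zero_smul, sub_zero]
  module

end UEF

theorem mainTheorem8 (U : Set UEF.Spacetime) (hU : IsOpen U)
    (g : UEF.Spacetime → Matrix (Fin 4) (Fin 4) ℝ)
    (hg : ∀ μ ν, ContDiffOn ℝ 1 (fun y => g y μ ν) U)
    (hL : ∀ y ∈ U, UEF.IsLorentzian (g y)) (c : ℝ → ℝ) :
    -- the flow is the second order system `∂Φ/∂λ = J(λ, Φ, ∂Φ, ∂²Φ)`
    (∀ (I : Set ℝ) (W : Set UEF.Param) (Φ : ℝ → UEF.Param → UEF.Spacetime), IsOpen W →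
      UEF.IsSpacelikeFamily U g I W Φ →
      (UEF.IsUniformlyExpandingFlow g c I W Φ ↔ UEF.SolvesSystem g c I W Φ)) ∧
    -- its symmetrized principal symbol is indefinite
    (∀ (l : ℝ) (y : UEF.Spacetime) (p : UEF.Jet1) (r : UEF.Jet2) (z : Fin 2 → ℝ),
      UEF.IsAdmissible U g y p r z →
      DifferentiableAt ℝ (UEF.flowRHS g c l y p) r ∧
      (∃ L, UEF.ExtendsNormalMetric (g y) p (UEF.jetMeanCurvature g y p r) L) ∧
      (∀ L, UEF.ExtendsNormalMetric (g y) p (UEF.jetMeanCurvature g y p r) L →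
        Module.End.HasEigenvector
          (Matrix.toLin' (UEF.symmetrized L (UEF.principalSymbol g c l y p r z)))
          (2 / UEF.jetHSq g y p r) (UEF.jetMeanCurvature g y p r) ∧
        Module.End.HasEigenvector
          (Matrix.toLin' (UEF.symmetrized L (UEF.principalSymbol g c l y p r z)))
          (-2 / UEF.jetHSq g y p r) (UEF.hodge (g y) p (UEF.jetMeanCurvature g y p r)) ∧
        (∀ A, UEF.symmetrized L (UEF.principalSymbol g c l y p r z) *ᵥ p A = 0) ∧
        UEF.IsIndefinite (g y) p L
          (UEF.symmetrized L (UEF.principalSymbol g c l y p r z))) ∧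
      -- indefiniteness does not depend on the symmetrizing metric
      (|c l| ≤ 1 → ∀ L : Matrix (Fin 4) (Fin 4) ℝ, L.PosDef →
        UEF.IsIndefinite (g y) p L
          (UEF.symmetrized L (UEF.principalSymbol g c l y p r z)))) := by
  refine ⟨fun I W Φ hW hΦ => ?_, fun l y p r z had => ?_⟩
  · have hH : ∀ l ∈ I, ∀ x ∈ W, UEF.meanCurvature g (Φ l) x
        = UEF.jetMeanCurvature g (Φ l x) (UEF.tangent (Φ l) x) (UEF.secondDeriv (Φ l) x) :=
      fun l hl x hx => UEF.meanCurvature_eq_jetMeanCurvature hU hL hW (hΦ l hl).1 hx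
        ((hΦ l hl).2 x hx).1
    refine forall₂_congr fun l hl => forall₂_congr fun x hx => ?_
    rw [hH l hl x hx, UEF.jetHSq, UEF.flowRHS]
  · have hG := hL y had.mem
    have hp := had.spacelike
    have hpos := had.hSq_pos
    have hd := UEF.dMetric_swap hU hL had.mem
    have hH : UEF.IsNormal (g y) p (UEF.jetMeanCurvature g y p r) :=
      UEF.jetMeanCurvature_isNormal hG.transpose_eq hG.isUnit_det hd had.symm hp
    have hQ := UEF.isSymbol_principalSymbol hG hd had.symm had.unit c l hp hpos
    refine ⟨UEF.differentiableAt_flowRHS hG.isUnit_det c l hpos,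
      UEF.exists_extendsNormalMetric hG hp hH hpos, fun L hLext => ?_,
      fun hc L hLpos => hQ.isIndefinite hG hp hH hpos hc hLpos⟩
    obtain ⟨h1, h2, h3⟩ := hLext.symmetrized_mulVec hQ hG hp hH hpos
    refine ⟨Module.End.hasEigenvector_iff.2 ⟨Module.End.mem_eigenspace_iff.2 h1,
        UEF.ne_zero_of_ip_ne_zero hpos.ne'⟩,
      Module.End.hasEigenvector_iff.2 ⟨Module.End.mem_eigenspace_iff.2 h2,
        UEF.ne_zero_of_ip_ne_zero (G := g y) ?_⟩,
      h3, hLext.isIndefinite hQ hG hp hH hpos⟩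
    rw [UEF.ip_hodge_hodge hG hp hH hpos]
    exact (neg_neg_of_pos hpos).ne
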